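/- Let $k\ge 2$ and let $c=c_0c_1\cdots c_{k-1}$ be a word of non-negative integers with $c_0\ge 1$ and $c_{k-1}\ge 1$. Let $\mu_c$ be the morphism on words over $\{0,\dots,k-1\}$ given by $\mu_c(i)=0^{c_i}\,(i+1)$ for $0\le i\le k-2$ and $\mu_c(k-1)=0^{c_{k-1}}$. Put $u_n=\mu_c^n(0)$ and $U_n=|u_n|$ for $n\ge 0$, and let $\mathbf u_c=\lim_{n\to\infty}u_n$ be the infinite fixed point of $\mu_c$ starting with $0$. A word over $\mathbb N$ is anti-Lyndon if it is non-empty, primitive, and lexicographically minimal among its conjugates for the lexicographic order induced by the inverse of the usual order on $\mathbb N$. A string attractor of a finite word $y$ of length $m$ is a set $\Gamma\subseteq\{1,\dots,m\}$ of positions such that every non-empty factor of $y$ has an occurrence in $y$ that contains a position of $\Gamma$. For $m\ge 1$ let $s_{\mathbf u_c}(m)$ denote the smallest size of a string attractor of the length-$m$ prefix of $\mathbf u_c$. If $c=w^\ell 1$ for some integer $\ell\ge 1$ and some anti-Lyndon word $w$, then \[ s_{\mathbf u_c}(m)=\begin{cases} i+1, & \text{if } U_i\le m<U_{i+1} \text{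 with } 0\le i\le k-2,\\ k, & \text{if } m\ge U_{k-1}.\end{cases} \] -/

import Mathlib

/-- The `n`-th power `w ^ n` of a finite word. -/
def wordPow {A : Type*} (w : List A) (n : ℕ) : List A :=
  (List.replicate n w).flatten

/-- A non-empty word is primitive if it is not a proper power of a non-empty word. -/
def IsPrimitiveWord {A : Type*} (w : List A) : Prop :=
  w ≠ [] ∧ ∀ (u : List A) (n : ℕ), u ≠ [] → w = wordPow u n → n = 1

/-- `w` is Lyndon for the (strict) order `lt` on letters: it is primitive, and smaller than or
equal to each of its conjugates in the lexicographic order induced by `lt`. -/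
def IsLyndonWord {A : Type*} (lt : A → A → Prop) (w : List A) : Prop :=
  IsPrimitiveWord w ∧ ∀ v : List A, v ~r w → w = v ∨ List.Lex lt w v

/-- `w` is anti-Lyndon: Lyndon for the inverse order on the letters. -/
def IsAntiLyndonWord {A : Type*} [LinearOrder A] (w : List A) : Prop :=
  IsLyndonWord (fun a b : A => b < a) w

/-- The standing hypothesis on the parameters `c = c_0 ⋯ c_{k-1}`, with `k = c.length`:
`k ≥ 2` and `c_0, c_{k-1} ≥ 1`. -/
def WorkingHypothesis (c : List ℕ) : Prop :=
  2 ≤ c.length ∧ 1 ≤ c.getD 0 0 ∧ 1 ≤ c.getD (c.length - 1) 0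

/-- The image of a letter: `0^{c_i} (i+1)` if `i ≤ k-2`, and `0^{c_{k-1}}` if `i = k-1`.
(Numbers `i ≥ k` are not letters; they never occur below, and their image here is empty.) -/
def letterImage (c : List ℕ) (i : ℕ) : List ℕ :=
  List.replicate (c.getD i 0) 0 ++ (if i + 1 < c.length then [i + 1] else [])

/-- The morphism `μ_c` on words. -/
def morph (c : List ℕ) (y : List ℕ) : List ℕ :=
  y.flatMap (letterImage c)

/-- The word `u_{c,n} = μ_c^n(0)`. -/
def finWord (c : List ℕ) (n : ℕ) : List ℕ :=
  (morph c)^[n] [0]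

/-- The length `U_{c,n} = |u_{c,n}|`. -/
def finLength (c : List ℕ) (n : ℕ) : ℕ :=
  (finWord c n).length

/-- The infinite word `u_c = lim u_{c,n}`, indexed from `0`. Under the standing hypothesis
`u_{c,i+1}` has more than `i` letters, and every `u_{c,n}` is a prefix of `u_c`: this is
`fixedWord_prefix` below. -/
def fixedWord (c : List ℕ) (i : ℕ) : ℕ :=
  (finWord c (i + 1)).getD i 0

/-- The prefix of length `m` of an infinite word. -/
def infPrefix {A : Type*} (x : ℕ → A) (m : ℕ) : List A :=
  (List.range m).map x

/-- `Γ` is a string attractor of the finite word `y` (positions are counted from `1`): it is a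
set of positions of `y`, and each non-empty factor `x` of `y` has an occurrence `y = p x s`, on
the positions `|p| + 1, …, |p| + |x|`, that contains an element of `Γ`. -/
def IsStringAttractor {A : Type*} (Γ : Finset ℕ) (y : List A) : Prop :=
  Γ ⊆ Finset.Icc 1 y.length ∧
    ∀ x : List A, x ≠ [] → x <:+: y →
      ∃ p s : List A, y = p ++ x ++ s ∧
        ∃ i ∈ Γ, p.length + 1 ≤ i ∧ i ≤ p.length + x.length

/-- The string attractor profile function: the least size of a string attractor of the prefix of
length `n` (the set is never empty, by `exists_stringAttractor`). -/
noncomputable def attractorProfile {A : Type*} (x : ℕ → A) (n : ℕ) : ℕ :=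
  sInf {s : ℕ | ∃ Γ : Finset ℕ, IsStringAttractor Γ (infPrefix x n) ∧ Γ.card = s}

theorem exists_stringAttractor {A : Type*} (y : List A) :
    ∃ Γ : Finset ℕ, IsStringAttractor Γ y := by
  refine ⟨Finset.Icc 1 y.length, subset_rfl, ?_⟩
  rintro x hx ⟨p, s, h⟩
  have hl : 0 < x.length := List.length_pos_iff.2 hx
  refine ⟨p, s, h.symm, p.length + 1, ?_, le_rfl, by omega⟩
  subst h
  simp only [List.length_append, Finset.mem_Icc]
  omega

theorem finWord_succ (c : List ℕ) (n : ℕ) : finWord c (n + 1) = morph c (finWord c n) :=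
  Function.iterate_succ_apply' _ _ _

theorem morph_append (c y z : List ℕ) : morph c (y ++ z) = morph c y ++ morph c z := by
  simp [morph]

theorem finWord_prefix_succ {c : List ℕ} (hc : WorkingHypothesis c) (n : ℕ) :
    ∃ t, t ≠ [] ∧ (∀ a ∈ t, a < c.length) ∧ finWord c (n + 1) = finWord c n ++ t := by
  obtain ⟨hk, h0, hl⟩ := hc
  induction n with
  | zero =>
    obtain ⟨b, hb⟩ : ∃ b, c.getD 0 0 = b + 1 := ⟨c.getD 0 0 - 1, by omega⟩
    refine ⟨List.replicate b 0 ++ [1], by simp, ?_, ?_⟩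
    · intro a ha
      simp only [List.mem_append, List.mem_replicate, List.mem_singleton] at ha
      omega
    · have : 0 + 1 < c.length := by omega
      rw [finWord_succ]
      simp only [finWord, morph, Function.iterate_zero, id, List.flatMap_cons, List.flatMap_nil,
        letterImage, hb, if_pos this, List.replicate_succ]
      simp
  | succ n ih =>
    obtain ⟨t, ht, hlt, h⟩ := ih
    refine ⟨morph c t, ?_, ?_, ?_⟩
    · obtain ⟨a, t, rfl⟩ := List.exists_cons_of_ne_nil ht
      have ha := hlt a (by simp)
      intro h
      simp only [morph, List.flatMap_cons, List.append_eq_nil_iff, letterImage] at h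
      by_cases h1 : a + 1 < c.length
      · simp [h1] at h
      · have : a = c.length - 1 := by omega
        subst this
        have := h.1.1
        rw [List.replicate_eq_nil_iff] at this
        omega
    · intro a ha
      simp only [morph, List.mem_flatMap, letterImage, List.mem_append, List.mem_replicate] at ha
      obtain ⟨i, -, h | h⟩ := ha
      · omega
      · split_ifs at h with h1
        · simp only [List.mem_singleton] at h
          omega
        · simp at h
    · rw [finWord_succ c (n + 1), h, morph_append, ← finWord_succ, h]

theorem finWord_prefix_add {c : List ℕ} (hc : WorkingHypothesis c) (n d : ℕ) :
    finWord c n <+: finWord c (n + d) := by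
  induction d with
  | zero => exact List.prefix_refl _
  | succ d ih =>
    obtain ⟨t, -, -, h⟩ := finWord_prefix_succ hc (n + d)
    exact ih.trans ⟨t, h.symm⟩

theorem lt_finLength {c : List ℕ} (hc : WorkingHypothesis c) (n : ℕ) : n < finLength c n := by
  induction n with
  | zero => simp [finLength, finWord]
  | succ n ih =>
    obtain ⟨t, ht, -, h⟩ := finWord_prefix_succ hc n
    have := List.length_pos_iff.2 ht
    simp only [finLength, h, List.length_append] at ih ⊢
    omega

/-- `u_{c,n}` is the prefix of length `U_{c,n}` of `u_c`. -/
theorem fixedWord_prefix {c : List ℕ} (hc : WorkingHypothesis c) (n : ℕ) :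
    infPrefix (fixedWord c) (finLength c n) = finWord c n := by
  apply List.ext_getElem
  · simp [infPrefix, finLength]
  intro i h1 h2
  have h3 : i < (finWord c (i + 1)).length := by
    have := lt_finLength hc (i + 1)
    simp only [finLength] at this
    omega
  simp only [infPrefix, List.getElem_map, List.getElem_range, fixedWord]
  rw [List.getD_eq_getElem _ _ h3]
  rcases le_total n (i + 1) with h | h
  · obtain ⟨d, hd⟩ := Nat.exists_eq_add_of_le h
    have := finWord_prefix_add hc n d
    rw [← hd] at this
    exact (this.getElem h2).symm
  · obtain ⟨d, hd⟩ := Nat.exists_eq_add_of_le h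
    have := finWord_prefix_add hc (i + 1) d
    rw [← hd] at this
    exact this.getElem h3

/-!
Write `k = |c|`, `W = w^ω` and `P_n = U_n` if `n < k`, `P_n = U_n + U_{n-k+1} - U_{n-k} - 1` if
`n ≥ k`. The positions `U_{n-k+1}, …, U_n` (or `U_0, …, U_n` if `n < k`) form a string attractor of
each prefix of length `m` with `P_n ≤ m < P_{n+1}`; counting letters shows that it is as small as
possible.

The attractor is obtained by induction on `n` (`IsPowerOne.covers_lengthPositions`). If a word of
length at least `p` has period `p`, an attractor of its prefix of length `p - 1` becomes an
attractor of the word once `p` is added (`Covers.insert_period`). With `p = U_n` this yields one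
position too many for `n ≥ k`, and `U_{n-k}` can be dropped since `u_n` ends with `u_{n-k}`: a factor
seen around `U_{n-k}` only is seen again around `U_n`, if the prefix has at least the length `P_n`.

All this needs the prefix of length `P_{n+1} - 1` of `u_c` to have period `U_n`
(`IsPowerOne.threshold_succ_le`). The prefix of `u_c` with period `U_n` is computed exactly: it is
`u_n x_n`, where `x_0 = 0^{W_0 - 1}` and `x_{n+1} = μ_c(x_n) 0^{W_{n+1}}` (`overlap`). To see this, one
follows under `μ_c` the two letters at which `u_c` differs from its suffix starting after `u_n`.
They are `a < b` such that the factor of `W` of length `a` ending just before the index `b` is a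
prefix of `W`; so `W_b ≤ W_a`, because `W` is maximal among its shifts, and the images differ after
`0^{W_b}`. Once `b = k - 1` is reached, which is a multiple of `|w|`, the number `a` is a multiple of
`|w|` too, since `w` is unbordered, and the last digit `1` of `c` makes the process start afresh
with the two sides exchanged (`IsMismatch.morph`). Finally `u_n x_n = u_{n+1} x_{n-k+1}` for
`n ≥ k - 1`, which gives the required length.
-/

/-! ### The periodic word of an anti-Lyndon word -/

/-- The infinite periodic word `w^ω`. -/
def periodicWord (w : List ℕ) (i : ℕ) : ℕ :=
  w.getD (i % w.length) 0

theorem periodicWord_congr (w : List ℕ) {x y : ℕ} (h : x ≡ y [MOD w.length]) :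
    periodicWord w x = periodicWord w y := by
  rw [periodicWord, periodicWord, h]

theorem getElem?_wordPow {w : List ℕ} (hw : w ≠ []) {l i : ℕ} (hi : i < l * w.length) :
    (wordPow w l)[i]? = some (periodicWord w i) := by
  have hpos := List.length_pos_iff.2 hw
  induction l generalizing i with
  | zero => simp at hi
  | succ l ih =>
    have hs : wordPow w (l + 1) = w ++ wordPow w l := by
      simp [wordPow, List.replicate_succ]
    rw [hs]
    rcases lt_or_ge i w.length with h | h
    · rw [List.getElem?_append_left h, periodicWord, Nat.mod_eq_of_lt h,
        List.getD_eq_getElem _ _ h, List.getElem?_eq_getElem h]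
    · rw [List.getElem?_append_right h, ih (by rw [Nat.succ_mul] at hi; omega)]
      congr 1
      apply periodicWord_congr
      exact (Nat.modEq_iff_dvd' (by omega)).2 ⟨1, by omega⟩

theorem length_wordPow (w : List ℕ) (l : ℕ) : (wordPow w l).length = l * w.length := by
  simp [wordPow]

theorem getElem?_rotate_eq_periodicWord {w : List ℕ} {s i : ℕ} (hi : i < w.length) :
    (w.rotate s)[i]? = some (periodicWord w (s + i)) := by
  have h1 : (s + i) % w.length < w.length := Nat.mod_lt _ (by omega)
  rw [List.getElem?_rotate hi, periodicWord, add_comm i s, List.getD_eq_getElem _ _ h1,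
    List.getElem?_eq_getElem h1]

theorem List.Lex.exists_first_mismatch {r : ℕ → ℕ → Prop} {a b : List ℕ} (h : List.Lex r a b)
    (hl : a.length = b.length) :
    ∃ i, ∃ h1 : i < a.length, ∃ h2 : i < b.length, r a[i] b[i] ∧
      ∀ j, j < i → a[j]? = b[j]? := by
  induction h with
  | nil => simp at hl
  | @cons x as bs _ ih =>
    obtain ⟨i, h1, h2, h3, h4⟩ := ih (by simpa using hl)
    refine ⟨i + 1, by simpa using h1, by simpa using h2, by simpa using h3, ?_⟩
    rintro (_ | j) hj
    · simp
    · simpa using h4 j (by omega)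
  | @rel x as y bs hr => exact ⟨0, by simp, by simp, by simpa using hr, by simp⟩

/-- A primitive word differs from each of its non-trivial rotations: equality would make
`w^ω` periodic with period `gcd (s, |w|)`. -/
theorem IsPrimitiveWord.rotate_ne {w : List ℕ} (hw : IsPrimitiveWord w) {s : ℕ}
    (hs : ¬ w.length ∣ s) : w.rotate s ≠ w := by
  intro h
  have hpos := List.length_pos_iff.2 hw.1
  set g := Nat.gcd s w.length with hg
  have hgpos : 0 < g := Nat.gcd_pos_of_pos_right _ hpos
  have hgw : g ∣ w.length := Nat.gcd_dvd_right _ _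
  have hper : ∀ n, w.rotate (s * n) = w := by
    intro n
    induction n with
    | zero => simp
    | succ n ih => rw [Nat.mul_succ, ← List.rotate_rotate, ih, h]
  have hrot : w.rotate g = w := by
    obtain ⟨m, -, hm⟩ := Nat.exists_mul_mod_eq_gcd (k := w.length) (n := s)
      ((Nat.le_of_dvd hpos hgw).lt_of_ne fun he => hs (he ▸ Nat.gcd_dvd_left _ _))
    rw [hg, ← hm, List.rotate_mod, hper]
  have hper' : ∀ n, w.rotate (g * n) = w := by
    intro n
    induction n with
    | zero => simp
    | succ n ih => rw [Nat.mul_succ, ← List.rotate_rotate, ih, hrot]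
  have hlen : (w.take g).length = g := by
    simpa using Nat.le_of_dvd hpos hgw
  have hne : w.take g ≠ [] := List.length_pos_iff.1 (by omega)
  have hw' : w = wordPow (w.take g) (w.length / g) := by
    apply List.ext_getElem?
    intro i
    rcases lt_or_ge i w.length with hi | hi
    · have hi' : i < w.length / g * (w.take g).length := by
        rwa [hlen, Nat.div_mul_cancel hgw]
      have h1 : i % g < g := Nat.mod_lt _ hgpos
      have h2 : i % g < w.length := (Nat.mod_le _ _).trans_lt hi
      have h3 := getElem?_rotate_eq_periodicWord (s := g * (i / g)) h2
      rw [hper', Nat.div_add_mod] at h3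
      have h4 := getElem?_rotate_eq_periodicWord (s := 0) hi
      rw [List.rotate_zero, zero_add] at h4
      rw [getElem?_wordPow hne hi', h4, ← h3, periodicWord, hlen, List.getElem?_eq_getElem h2,
        List.getD_eq_getElem _ _ (by omega)]
      simp
    · rw [List.getElem?_eq_none hi, List.getElem?_eq_none]
      rwa [length_wordPow, hlen, Nat.div_mul_cancel hgw]
  have h1 := hw.2 _ _ hne hw'
  have h2 := Nat.div_mul_cancel hgw
  rw [h1, one_mul] at h2
  exact hs (h2 ▸ Nat.gcd_dvd_left _ _)

/-- A shift of `w^ω` by a non-multiple of `|w|` is smaller than `w^ω`, and the first mismatch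
occurs within the first `|w|` letters. -/
theorem IsAntiLyndonWord.exists_first_mismatch {w : List ℕ} (hw : IsAntiLyndonWord w)
    {s : ℕ} (hs : ¬ w.length ∣ s) :
    ∃ r, (∀ i < r, periodicWord w (s + i) = periodicWord w i) ∧
      periodicWord w (s + r) < periodicWord w r := by
  have hne := hw.1.rotate_ne hs
  obtain h | h := hw.2 (w.rotate s) (List.IsRotated.symm ⟨s, rfl⟩)
  · exact absurd h.symm hne
  obtain ⟨r, h1, h2, h3, h4⟩ := h.exists_first_mismatch (by simp)
  have key : ∀ i < w.length, w[i]? = some (periodicWord w i) ∧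
      (w.rotate s)[i]? = some (periodicWord w (s + i)) := by
    intro i hi
    refine ⟨?_, getElem?_rotate_eq_periodicWord hi⟩
    have := getElem?_rotate_eq_periodicWord (s := 0) hi
    rwa [List.rotate_zero, zero_add] at this
  refine ⟨r, fun i hi => ?_, ?_⟩
  · have h5 := h4 i hi
    rw [(key i (by omega)).1, (key i (by omega)).2] at h5
    exact (Option.some.inj h5).symm
  · have h5 := (key r h1).1
    have h6 := (key r h1).2
    rw [List.getElem?_eq_getElem h1] at h5
    rw [List.getElem?_eq_getElem h2] at h6
    rwa [Option.some.inj h5, Option.some.inj h6] at h3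

/-- The word `w^ω` is maximal among its shifts. -/
theorem IsAntiLyndonWord.periodicWord_le {w : List ℕ} (hw : IsAntiLyndonWord w)
    {s t : ℕ}
    (h : ∀ i < t, periodicWord w (s + i) = periodicWord w i) :
    periodicWord w (s + t) ≤ periodicWord w t := by
  by_cases hs : w.length ∣ s
  · refine (periodicWord_congr w ?_).le
    simpa using (Nat.modEq_zero_iff_dvd.2 hs).add_right t
  · obtain ⟨r, h1, h2⟩ := hw.exists_first_mismatch hs
    rcases lt_trichotomy t r with h3 | rfl | h3
    · exact (h1 t h3).le
    · exact h2.le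
    · exact absurd (h r h3) h2.ne

/-- An anti-Lyndon word is unbordered: a prefix of `w^ω` that is also read in `w^ω` just before
a multiple of `|w|` has length a multiple of `|w|`. -/
theorem IsAntiLyndonWord.dvd_of_border {w : List ℕ} (hw : IsAntiLyndonWord w)
    {s t : ℕ}
    (h : ∀ i < t, periodicWord w (s + i) = periodicWord w i) (hst : w.length ∣ s + t) :
    w.length ∣ t := by
  by_contra ht
  have hs : ¬ w.length ∣ s := fun hs => ht ((Nat.dvd_add_right hs).1 hst)
  obtain ⟨r, h1, h2⟩ := hw.exists_first_mismatch hs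
  have htr : t ≤ r := by
    by_contra hlt
    exact h2.ne (h r (by omega))
  have key : ∀ i, periodicWord w (s + (t + i)) = periodicWord w i := fun i =>
    periodicWord_congr w (by simpa [add_assoc] using (Nat.modEq_zero_iff_dvd.2 hst).add_right i)
  -- the mismatch of the shift by `s` would contradict maximality with respect to the shift by `t`
  have h3 := hw.periodicWord_le (s := t) (t := r - t) fun i hi => by
    rw [← key i, h1 _ (by omega)]
  rw [show t + (r - t) = r by omega, ← key (r - t), show s + (t + (r - t)) = s + r by omega] at h3
  omega

/-! ### The morphism for `c = w^ℓ 1` -/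

/-- The parameters `c = w^ℓ 1`, with `w` anti-Lyndon, under the standing hypothesis (whose part
`k ≥ 2` forces `ℓ ≥ 1`). -/
structure IsPowerOne (c w : List ℕ) (l : ℕ) : Prop where
  working : WorkingHypothesis c
  antiLyndon : IsAntiLyndonWord w
  eq : c = wordPow w l ++ [1]

namespace IsPowerOne

variable {c w : List ℕ} {l : ℕ}

theorem length_eq (h : IsPowerOne c w l) : c.length = l * w.length + 1 := by
  rw [h.eq, List.length_append, length_wordPow, List.length_singleton]

theorem dvd_length_sub_one (h : IsPowerOne c w l) : w.length ∣ c.length - 1 :=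
  ⟨l, by rw [h.length_eq, Nat.add_sub_cancel, mul_comm]⟩

theorem two_le (h : IsPowerOne c w l) : 2 ≤ c.length := h.working.1

theorem getD_eq (h : IsPowerOne c w l) {i : ℕ} (hi : i + 1 < c.length) :
    c.getD i 0 = periodicWord w i := by
  have hl := h.length_eq
  have hi' : i < l * w.length := by omega
  rw [h.eq, List.getD_eq_getElem?_getD, List.getElem?_append_left (by rwa [length_wordPow]),
    getElem?_wordPow h.antiLyndon.1.1 hi', Option.getD_some]

theorem getD_last (h : IsPowerOne c w l) : c.getD (c.length - 1) 0 = 1 := by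
  rw [h.length_eq, Nat.add_sub_cancel, h.eq, List.getD_eq_getElem?_getD,
    List.getElem?_append_right (by rw [length_wordPow]), length_wordPow]
  simp

theorem one_le_periodicWord_zero (h : IsPowerOne c w l) : 1 ≤ periodicWord w 0 := by
  rw [← h.getD_eq (i := 0) (by have := h.two_le; omega)]
  exact h.working.2.1

theorem letterImage_eq (h : IsPowerOne c w l) {i : ℕ} (hi : i + 1 < c.length) :
    letterImage c i = List.replicate (periodicWord w i) 0 ++ [i + 1] := by
  rw [letterImage, if_pos hi, h.getD_eq hi]

theorem letterImage_last (h : IsPowerOne c w l) : letterImage c (c.length - 1) = [0] := by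
  have := h.two_le
  rw [letterImage, if_neg (by omega), h.getD_last]
  rfl

end IsPowerOne

theorem morph_singleton (c : List ℕ) (i : ℕ) : morph c [i] = letterImage c i := by
  simp [morph]

theorem iterate_morph_append (c : List ℕ) (n : ℕ) (y z : List ℕ) :
    (morph c)^[n] (y ++ z) = (morph c)^[n] y ++ (morph c)^[n] z := by
  induction n generalizing y z with
  | zero => rfl
  | succ n ih => rw [Function.iterate_succ_apply, morph_append, ih]; rfl

theorem iterate_morph_finWord (c : List ℕ) (n m : ℕ) :
    (morph c)^[n] (finWord c m) = finWord c (m + n) := by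
  rw [finWord, ← Function.iterate_add_apply, add_comm m n]; rfl

/-- `v` is a prefix of the fixed point `u_c`. -/
def IsFixedPrefix (c v : List ℕ) : Prop :=
  ∃ N, v <+: finWord c N

namespace IsFixedPrefix

variable {c v : List ℕ}

theorem of_prefix {v' : List ℕ} (h : IsFixedPrefix c v) (hv : v' <+: v) : IsFixedPrefix c v' :=
  let ⟨N, hN⟩ := h
  ⟨N, hv.trans hN⟩

theorem finWord (c : List ℕ) (n : ℕ) : IsFixedPrefix c (finWord c n) :=
  ⟨n, List.prefix_refl _⟩

theorem morph (h : IsFixedPrefix c v) : IsFixedPrefix c (morph c v) := by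
  obtain ⟨N, t, ht⟩ := h
  exact ⟨N + 1, _root_.morph c t, by rw [← morph_append, ht, finWord_succ]⟩

theorem getElem (hc : WorkingHypothesis c) (h : IsFixedPrefix c v) {i : ℕ} (hi : i < v.length) :
    v[i] = fixedWord c i := by
  obtain ⟨N, hN⟩ := h
  have h1 := fixedWord_prefix hc N
  rw [hN.getElem hi]
  simp only [← h1, infPrefix, List.getElem_map, List.getElem_range]

end IsFixedPrefix

/-- In the words `u_n`, a letter is followed either by `0` or by a larger letter. In particular
the largest letter is always followed by `0`. -/
theorem IsPowerOne.isChain_morph {c w : List ℕ} {l : ℕ} (h : IsPowerOne c w l) {y : List ℕ}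
    (hy : y.IsChain fun i j => j = 0 ∨ (i < j ∧ j < c.length)) :
    (morph c y).IsChain fun i j => j = 0 ∨ (i < j ∧ j < c.length) := by
  have h2 := h.two_le
  have himg : ∀ i, (letterImage c i).IsChain fun i j => j = 0 ∨ (i < j ∧ j < c.length) := by
    intro i
    rw [letterImage, List.isChain_append]
    refine ⟨List.isChain_replicate_of_rel _ (Or.inl rfl), by split_ifs <;> simp, ?_⟩
    intro x hx z hz
    have hx' := List.mem_of_mem_getLast? hx
    rw [List.mem_replicate] at hx'
    split_ifs at hz with h1
    · simp only [List.head?_cons, Option.mem_def, Option.some.injEq] at hz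
      right
      omega
    · simp at hz
  induction y with
  | nil => simp [morph]
  | cons i y ih =>
    rw [show morph c (i :: y) = letterImage c i ++ morph c y by simp [morph], List.isChain_append]
    refine ⟨himg i, ih hy.tail, ?_⟩
    intro x hx z hz
    rcases y with _ | ⟨j, y⟩
    · simp [morph] at hz
    have hij : j = 0 ∨ (i < j ∧ j < c.length) := by
      simp only [List.isChain_cons_cons] at hy
      exact hy.1
    rw [show morph c (j :: y) = letterImage c j ++ morph c y by simp [morph]] at hz
    rcases Nat.eq_zero_or_pos (c.getD j 0) with h0 | h0
    · have hj : j ≠ 0 := by rintro rfl; have := h.working.2.1; omega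
      have hj' : j ≠ c.length - 1 := by rintro rfl; have := h.getD_last; omega
      rw [letterImage, h0, if_pos (by omega)] at hz
      rw [letterImage, if_pos (by omega), List.getLast?_append] at hx
      simp at hz hx
      right
      omega
    · obtain ⟨d, hd⟩ : ∃ d, c.getD j 0 = d + 1 := ⟨_, (Nat.succ_pred_eq_of_pos h0).symm⟩
      rw [letterImage, hd, List.replicate_succ] at hz
      simp at hz
      exact Or.inl hz.symm

theorem IsPowerOne.isChain_finWord {c w : List ℕ} {l : ℕ} (h : IsPowerOne c w l) (n : ℕ) :
    (finWord c n).IsChain fun i j => j = 0 ∨ (i < j ∧ j < c.length) := by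
  induction n with
  | zero => simp [finWord]
  | succ n ih => rw [finWord_succ]; exact h.isChain_morph ih

theorem IsPowerOne.isFixedPrefix_last_zero {c w v : List ℕ} {l : ℕ} (h : IsPowerOne c w l)
    (hv : IsFixedPrefix c (v ++ [c.length - 1])) :
    IsFixedPrefix c (v ++ [c.length - 1] ++ [0]) := by
  obtain ⟨N, t, ht⟩ := hv
  obtain ⟨t', hne, -, ht'⟩ := finWord_prefix_succ h.working N
  rw [← ht] at ht'
  obtain ⟨d, s, hds⟩ : ∃ d s, t ++ t' = d :: s :=
    List.exists_cons_of_ne_nil (by simp [hne])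
  rw [List.append_assoc, hds] at ht'
  have hch := h.isChain_finWord (N + 1)
  rw [ht', List.isChain_append] at hch
  have := hch.2.2 (c.length - 1) (by simp) d (by simp)
  obtain rfl : d = 0 := by omega
  exact ⟨N + 1, s, by rw [ht']; simp⟩

/-! ### Periods of the prefixes of the fixed point -/

/-- The word `x_n` with `x_0 = 0^{w_0 - 1}` and `x_{n+1} = μ_c(x_n) 0^{w_{n+1}}` (indices in
`w^ω`): the longest common prefix of `u_c` and of its suffix starting after `u_n`. -/
def overlap (c w : List ℕ) : ℕ → List ℕ
  | 0 => List.replicate (periodicWord w 0 - 1) 0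
  | n + 1 => morph c (overlap c w n) ++ List.replicate (periodicWord w (n + 1)) 0

/-- `p` and `p'` continue in `u_c` with distinct letters `s + a` and `a` such that
`w^ω` and its shift by `s` agree on their first `a` letters. -/
structure IsMismatch (c w p p' : List ℕ) (s a : ℕ) : Prop where
  pos : 0 < s
  lt : s + a < c.length
  agree : ∀ i < a, periodicWord w (s + i) = periodicWord w i
  left : IsFixedPrefix c (p ++ [s + a])
  right : IsFixedPrefix c (p' ++ [a])

/-- The morphism sends a mismatch to a mismatch. If the larger letter `s + a` is not the last one,
`c_{s+a} ≤ c_a` by maximality of `w^ω`, and `s + a` is replaced by `s + a + 1`. If it is the last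
one, then `a` is a multiple of `|w|` as `w` is unbordered, the images read `0 0^{w_0} ⋯` and
`0^{w_0} (a+1) ⋯`, and the two sides exchange their roles. -/
theorem IsMismatch.morph {c w p p' : List ℕ} {l s a : ℕ} (h : IsPowerOne c w l)
    (hm : IsMismatch c w p p' s a) :
    ∃ s' a', s' + a' ≡ s + a + 1 [MOD w.length] ∧
      (IsMismatch c w (morph c p ++ List.replicate (periodicWord w (s + a)) 0)
        (morph c p' ++ List.replicate (periodicWord w (s + a)) 0) s' a' ∨
      IsMismatch c w (morph c p' ++ List.replicate (periodicWord w (s + a)) 0)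
        (morph c p ++ List.replicate (periodicWord w (s + a)) 0) s' a') := by
  obtain ⟨hpos, hlt, hag, hl, hr⟩ := hm
  have hr' := hr.morph
  rw [morph_append, morph_singleton, h.letterImage_eq (by omega)] at hr'
  rcases Nat.lt_or_ge (s + a + 1) c.length with hb | hb
  · have hl' := hl.morph
    rw [morph_append, morph_singleton, h.letterImage_eq hb] at hl'
    have hle := h.antiLyndon.periodicWord_le hag
    rcases hle.lt_or_eq with hlt' | heq
    · refine ⟨s + a + 1, 0, rfl, Or.inl ⟨by omega, by omega, by simp, by simpa using hl', ?_⟩⟩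
      refine hr'.of_prefix ?_
      obtain ⟨d, hd⟩ := Nat.exists_eq_add_of_lt hlt'
      rw [hd, add_assoc, List.replicate_add, List.replicate_succ]
      simp
    · refine ⟨s, a + 1, rfl, Or.inl ⟨hpos, hb, ?_, by simpa [add_assoc] using hl',
        by rw [heq]; simpa using hr'⟩⟩
      intro i hi
      rcases Nat.lt_succ_iff_lt_or_eq.1 hi with hi | rfl
      · exact hag i hi
      · exact heq
  · have hsa : s + a = c.length - 1 := by omega
    have hd : w.length ∣ s + a := hsa ▸ h.dvd_length_sub_one
    have hda := h.antiLyndon.dvd_of_border hag hd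
    have e1 : periodicWord w (s + a) = periodicWord w 0 :=
      periodicWord_congr w (Nat.modEq_zero_iff_dvd.2 hd)
    have e2 : periodicWord w a = periodicWord w 0 :=
      periodicWord_congr w (Nat.modEq_zero_iff_dvd.2 hda)
    rw [hsa] at hl
    have hl' := (h.isFixedPrefix_last_zero hl).morph
    rw [morph_append, morph_append, morph_singleton, morph_singleton, h.letterImage_last,
      h.letterImage_eq (by have := h.two_le; omega)] at hl'
    refine ⟨a + 1, 0, ?_, Or.inr ⟨by omega, by omega, by simp, ?_, ?_⟩⟩
    · exact ((Nat.modEq_zero_iff_dvd.2 hda).trans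
        (Nat.modEq_zero_iff_dvd.2 hd).symm).add_right 1
    · rw [e1, ← e2]
      simpa using hr'
    · rw [e1]
      refine hl'.of_prefix ?_
      rw [List.append_assoc, List.append_assoc, List.prefix_append_right_inj,
        ← List.replicate_succ', List.replicate_succ]
      simp

/-- Both `u_n x_n` and `x_n` are prefixes of `u_c`. -/
theorem IsPowerOne.isMismatch_overlap {c w : List ℕ} {l : ℕ} (h : IsPowerOne c w l) (n : ℕ) :
    ∃ s a, s + a ≡ n + 1 [MOD w.length] ∧
      (IsMismatch c w (finWord c n ++ overlap c w n) (overlap c w n) s a ∨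
      IsMismatch c w (overlap c w n) (finWord c n ++ overlap c w n) s a) := by
  have h2 := h.two_le
  induction n with
  | zero =>
    have h1 : IsFixedPrefix c (List.replicate (periodicWord w 0) 0 ++ [1]) := by
      have := IsFixedPrefix.finWord c 1
      rwa [finWord_succ, show finWord c 0 = [0] from rfl, morph_singleton,
        h.letterImage_eq (by omega)] at this
    obtain ⟨d, hd⟩ := Nat.exists_eq_add_of_le' h.one_le_periodicWord_zero
    rw [hd] at h1
    refine ⟨1, 0, rfl, Or.inl ⟨by omega, by omega, by simp, ?_, ?_⟩⟩
    · simpa [overlap, finWord, hd, List.replicate_succ] using h1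
    · refine h1.of_prefix ?_
      rw [overlap, hd, Nat.add_sub_cancel, ← List.replicate_succ']
      exact List.prefix_append _ _
  | succ n ih =>
    obtain ⟨s, a, hmod, hm⟩ := ih
    have e := periodicWord_congr w hmod
    rcases hm with hm | hm
    all_goals
      obtain ⟨s', a', hmod', hm'⟩ := hm.morph h
      rw [e, morph_append, ← finWord_succ, List.append_assoc] at hm'
      exact ⟨s', a', hmod'.trans (hmod.add_right 1), by tauto⟩

theorem IsPowerOne.isFixedPrefix_overlap {c w : List ℕ} {l : ℕ} (h : IsPowerOne c w l) (n : ℕ) :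
    IsFixedPrefix c (finWord c n ++ overlap c w n) ∧ IsFixedPrefix c (overlap c w n) := by
  obtain ⟨s, a, -, hm | hm⟩ := h.isMismatch_overlap n
  · exact ⟨hm.left.of_prefix (List.prefix_append _ _), hm.right.of_prefix (List.prefix_append _ _)⟩
  · exact ⟨hm.right.of_prefix (List.prefix_append _ _), hm.left.of_prefix (List.prefix_append _ _)⟩

/-- The prefix `u_n x_n` of `u_c` has period `U_n`. -/
theorem IsPowerOne.fixedWord_add {c w : List ℕ} {l : ℕ} (h : IsPowerOne c w l) {n i : ℕ}
    (hi : i < (overlap c w n).length) :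
    fixedWord c (finLength c n + i) = fixedWord c i := by
  obtain ⟨h1, h2⟩ := h.isFixedPrefix_overlap n
  rw [← h2.getElem h.working hi, finLength, ← h1.getElem h.working (by simpa using hi)]
  simp

theorem IsPowerOne.finWord_succ_eq {c w : List ℕ} {l : ℕ} (h : IsPowerOne c w l) {n : ℕ}
    (hn : n + 1 < c.length) : finWord c (n + 1) = finWord c n ++ overlap c w n ++ [n + 1] := by
  induction n with
  | zero =>
    obtain ⟨d, hd⟩ := Nat.exists_eq_add_of_le' h.one_le_periodicWord_zero
    rw [finWord_succ, show finWord c 0 = [0] from rfl, morph_singleton, h.letterImage_eq hn,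
      overlap, hd, Nat.add_sub_cancel, List.replicate_succ]
    rfl
  | succ n ih =>
    rw [finWord_succ, ih (by omega), morph_append, morph_append, ← finWord_succ, ← ih (by omega),
      morph_singleton, h.letterImage_eq hn, overlap]
    simp

theorem IsPowerOne.finWord_length {c w : List ℕ} {l : ℕ} (h : IsPowerOne c w l) :
    finWord c c.length =
      finWord c (c.length - 1) ++ morph c (overlap c w (c.length - 2)) ++ [0] := by
  obtain ⟨k, hk⟩ := Nat.exists_eq_add_of_le' h.two_le
  have h1 := h.letterImage_last
  have h2 := h.finWord_succ_eq (n := k) (by omega)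
  rw [hk] at h1 ⊢
  simp only [Nat.add_sub_cancel, Nat.reduceSubDiff] at h1 ⊢
  rw [finWord_succ, h2, morph_append, morph_append, ← finWord_succ, ← h2, morph_singleton, h1]

/-- The word `u_{k+j}` starts with `u_{k-1+j}` and ends with a disjoint occurrence of `u_j`. -/
theorem IsPowerOne.finWord_length_add {c w : List ℕ} {l : ℕ} (h : IsPowerOne c w l) (j : ℕ) :
    ∃ s, finWord c (c.length + j) = finWord c (c.length - 1 + j) ++ s ++ finWord c j := by
  refine ⟨(morph c)^[j] (morph c (overlap c w (c.length - 2))), ?_⟩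
  rw [← iterate_morph_finWord, h.finWord_length, iterate_morph_append, iterate_morph_append,
    iterate_morph_finWord]
  rfl

theorem IsPowerOne.finWord_append_overlap {c w : List ℕ} {l : ℕ} (h : IsPowerOne c w l) (j : ℕ) :
    finWord c (c.length - 1 + j) ++ overlap c w (c.length - 1 + j) =
      finWord c (c.length + j) ++ overlap c w j := by
  have hk := h.two_le
  have hd := Nat.modEq_zero_iff_dvd.2 h.dvd_length_sub_one
  induction j with
  | zero =>
    obtain ⟨d, hd'⟩ := Nat.exists_eq_add_of_le' h.one_le_periodicWord_zero
    obtain ⟨k, hk⟩ := Nat.exists_eq_add_of_le' h.two_le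
    have h1 := h.finWord_length
    have e := periodicWord_congr w hd
    rw [hk] at h1 e ⊢
    simp only [Nat.add_sub_cancel, Nat.reduceSubDiff, add_zero] at h1 e ⊢
    rw [h1, overlap, overlap, e, hd', List.replicate_succ]
    simp
  | succ j ih =>
    have e : periodicWord w (c.length - 1 + j + 1) = periodicWord w (j + 1) :=
      periodicWord_congr w (by simpa [add_assoc] using hd.add_right (j + 1))
    rw [← add_assoc, ← add_assoc, overlap, overlap, e, finWord_succ, finWord_succ,
      ← List.append_assoc, ← morph_append, ih, morph_append, List.append_assoc]

/-! ### String attractors of prefixes of infinite words -/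

/-- Positional form of the attractor property for the prefix of length `m` of an infinite word:
each factor, given by a start `i` and a length `d`, has an occurrence that contains a position
of `Γ`. Positions in `Γ` are counted from `1`, starts from `0`. -/
def Covers {A : Type*} (f : ℕ → A) (Γ : Finset ℕ) (m : ℕ) : Prop :=
  ∀ i d, 0 < d → i + d ≤ m → ∃ i', i' + d ≤ m ∧ (∀ t < d, f (i' + t) = f (i + t)) ∧
    ∃ g ∈ Γ, i' < g ∧ g ≤ i' + d

namespace Covers

variable {A : Type*} {f : ℕ → A} {Γ Γ' : Finset ℕ} {m p : ℕ}

theorem mono (h : Covers f Γ m) (hs : Γ ⊆ Γ') : Covers f Γ' m := by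
  intro i d hd hi
  obtain ⟨i', h1, h2, g, hg, h3⟩ := h i d hd hi
  exact ⟨i', h1, h2, g, hs hg, h3⟩

/-- In a word of period `p`, a factor occurs with a start in the first period. There it either
contains the position `p`, or lies in the prefix of length `p - 1`. -/
theorem insert_period (h : Covers f Γ (p - 1)) (hp : 0 < p) (hpm : p ≤ m)
    (hper : ∀ i, p + i < m → f (p + i) = f i) : Covers f (insert p Γ) m := by
  have hmul : ∀ q r, p * q + r < m → f (p * q + r) = f r := by
    intro q r
    induction q with
    | zero => simp
    | succ q ih =>
      intro hq
      rw [Nat.mul_succ] at hq ⊢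
      rw [show p * q + p + r = p + (p * q + r) by ring, hper _ (by omega), ih (by omega)]
  intro i d hd hi
  have hdiv := Nat.div_add_mod i p
  have hlt := Nat.mod_lt i hp
  have hle := Nat.mod_le i p
  have hf : ∀ t < d, f (i % p + t) = f (i + t) := by
    intro t ht
    rw [← hmul (i / p) (i % p + t) (by omega)]
    congr 1
    omega
  by_cases hc : i % p + d ≤ p - 1
  · obtain ⟨i', h1, h2, g, hg, h3⟩ := h (i % p) d hd hc
    exact ⟨i', by omega, fun t ht => (h2 t ht).trans (hf t ht), g, Finset.mem_insert_of_mem hg, h3⟩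
  · exact ⟨i % p, by omega, hf, p, Finset.mem_insert_self _ _, hlt, by omega⟩

/-- A position `g` is superfluous if the factors meeting `Γ` in `g` only also occur across
another position of `Γ`. -/
theorem erase (h : Covers f Γ m) {g : ℕ}
    (hg : ∀ i d, i < g → g ≤ i + d → i + d ≤ m → (∀ g' ∈ Γ, g' ≠ g → i < g' → i + d < g') →
      ∃ i', i' + d ≤ m ∧ (∀ t < d, f (i' + t) = f (i + t)) ∧
        ∃ g' ∈ Γ, g' ≠ g ∧ i' < g' ∧ g' ≤ i' + d) : Covers f (Γ.erase g) m := by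
  intro i d hd hi
  obtain ⟨i', h1, h2, g₁, hg₁, h3⟩ := h i d hd hi
  by_cases hne : ∃ g' ∈ Γ, g' ≠ g ∧ i' < g' ∧ g' ≤ i' + d
  · obtain ⟨g', hg', hgg, h4⟩ := hne
    exact ⟨i', h1, h2, g', Finset.mem_erase.2 ⟨hgg, hg'⟩, h4⟩
  · push Not at hne
    obtain rfl : g₁ = g := by
      by_contra hgg
      have := hne g₁ hg₁ hgg h3.1
      omega
    obtain ⟨i₂, h4, h5, g', hg', hgg, h6⟩ := hg i' d h3.1 h3.2 h1 hne
    exact ⟨i₂, h4, fun t ht => (h5 t ht).trans (h2 t ht), g', Finset.mem_erase.2 ⟨hgg, hg'⟩, h6⟩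

theorem isStringAttractor (h : Covers f Γ m) (hΓ : Γ ⊆ Finset.Icc 1 m) :
    IsStringAttractor Γ (infPrefix f m) := by
  refine ⟨by simpa [infPrefix] using hΓ, ?_⟩
  rintro x hx ⟨s, t, hst⟩
  have hlen := congrArg List.length hst
  simp only [List.length_append, infPrefix, List.length_map, List.length_range] at hlen
  obtain ⟨i', h1, h2, g, hg, h3⟩ := h s.length x.length (List.length_pos_iff.2 hx) (by omega)
  have hxe : x = ((infPrefix f m).drop i').take x.length := by
    apply List.ext_getElem
    · simp [infPrefix]
      omega
    intro j hj _
    have h4 : (infPrefix f m)[s.length + j]'(by simp [infPrefix]; omega) = x[j] := by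
      simp [← hst, hj]
    rw [← h4]
    simp [infPrefix, h2 j hj]
  refine ⟨(infPrefix f m).take i', ((infPrefix f m).drop i').drop x.length, ?_, g, hg, ?_⟩
  · have h5 := List.take_append_drop x.length ((infPrefix f m).drop i')
    rw [← hxe] at h5
    rw [List.append_assoc, h5, List.take_append_drop]
  · simp only [List.length_take, infPrefix, List.length_map, List.length_range]
    omega

end Covers

/-- An attractor has at least as many positions as there are distinct letters. -/
theorem IsStringAttractor.card_le {A : Type*} [DecidableEq A] {f : ℕ → A} {Γ : Finset ℕ} {m : ℕ}
    (h : IsStringAttractor Γ (infPrefix f m)) {s : Finset A} (hs : ∀ a ∈ s, ∃ i < m, f i = a) :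
    s.card ≤ Γ.card := by
  refine (Finset.card_le_card fun a ha => ?_).trans (Finset.card_image_le (f := fun g => f (g - 1)))
  obtain ⟨i, hi, rfl⟩ := hs a ha
  have hmem : f i ∈ infPrefix f m := List.mem_map.2 ⟨i, by simpa using hi, rfl⟩
  obtain ⟨p, s, hps⟩ := List.append_of_mem hmem
  obtain ⟨p, s, hy, g, hg, h1, h2⟩ := h.2 [f i] (by simp) ⟨p, s, by simp [hps]⟩
  obtain rfl : g = p.length + 1 := by
    simp only [List.length_singleton] at h2
    omega
  refine Finset.mem_image.2 ⟨_, hg, ?_⟩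
  have hlt : p.length < (infPrefix f m).length := by rw [hy]; simp
  have h3 : (infPrefix f m)[p.length] = f i := by simp [hy]
  simpa [infPrefix] using h3

theorem attractorProfile_eq {A : Type*} {f : ℕ → A} {m s : ℕ} {Γ : Finset ℕ}
    (h : IsStringAttractor Γ (infPrefix f m)) (hs : Γ.card = s)
    (hle : ∀ Γ' : Finset ℕ, IsStringAttractor Γ' (infPrefix f m) → s ≤ Γ'.card) :
    attractorProfile f m = s := by
  have hleast : IsLeast {s : ℕ | ∃ Γ : Finset ℕ, IsStringAttractor Γ (infPrefix f m) ∧ Γ.card = s}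
      s := ⟨⟨Γ, h, hs⟩, by rintro _ ⟨Γ', h', rfl⟩; exact hle Γ' h'⟩
  exact hleast.csInf_eq

/-! ### Attractors made of the lengths `U_n` -/

theorem finLength_strictMono {c : List ℕ} (hc : WorkingHypothesis c) :
    StrictMono (finLength c) := by
  refine strictMono_nat_of_lt_succ fun n => ?_
  obtain ⟨t, ht, -, h⟩ := finWord_prefix_succ hc n
  have := List.length_pos_iff.2 ht
  simp only [finLength, h, List.length_append]
  omega

theorem finLength_zero (c : List ℕ) : finLength c 0 = 1 := rfl

namespace IsPowerOne

variable {c w : List ℕ} {l : ℕ}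

theorem finLength_succ (h : IsPowerOne c w l) {n : ℕ} (hn : n + 1 < c.length) :
    finLength c (n + 1) = finLength c n + (overlap c w n).length + 1 := by
  simp only [finLength, h.finWord_succ_eq hn, List.length_append, List.length_singleton]

theorem finLength_length_add (h : IsPowerOne c w l) (j : ℕ) :
    finLength c (c.length - 1 + j) + finLength c j ≤ finLength c (c.length + j) := by
  obtain ⟨s, hs⟩ := h.finWord_length_add j
  simp only [finLength, hs, List.length_append]
  omega

theorem finLength_add_overlap (h : IsPowerOne c w l) (j : ℕ) :
    finLength c (c.length - 1 + j) + (overlap c w (c.length - 1 + j)).length =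
      finLength c (c.length + j) + (overlap c w j).length := by
  simpa [finLength] using congrArg List.length (h.finWord_append_overlap j)

/-- The word `u_{n+1}` without its last letter has period `U_n`. -/
theorem finLength_succ_le (h : IsPowerOne c w l) (n : ℕ) :
    finLength c (n + 1) ≤ finLength c n + (overlap c w n).length + 1 := by
  rcases Nat.lt_or_ge (n + 1) c.length with hn | hn
  · exact (h.finLength_succ hn).le
  · have h2 := h.two_le
    obtain ⟨j, rfl⟩ := Nat.exists_eq_add_of_le (show c.length - 1 ≤ n by omega)
    rw [h.finLength_add_overlap, show c.length - 1 + j + 1 = c.length + j by omega]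
    omega

/-- The word `u_j` is a suffix of `u_{k+j}`. -/
theorem fixedWord_suffix (h : IsPowerOne c w l) {i j : ℕ} (hi : i < finLength c j) :
    fixedWord c (finLength c (c.length + j) - finLength c j + i) = fixedWord c i := by
  obtain ⟨s, hs⟩ := h.finWord_length_add j
  have h1 := IsFixedPrefix.finWord c (c.length + j)
  have h2 := IsFixedPrefix.finWord c j
  rw [hs] at h1
  have hi' : i < (finWord c j).length := hi
  have e : finLength c (c.length + j) - finLength c j + i =
      (finWord c (c.length - 1 + j) ++ s).length + i := by
    simp only [finLength, hs, List.length_append]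
    omega
  rw [e, ← h1.getElem h.working (by rw [List.length_append (bs := finWord c j)]; omega),
    ← h2.getElem h.working hi', List.getElem_append_right (by omega)]
  simp

end IsPowerOne

/-- The positions `U_{n-k+1}, …, U_n` (or `U_0, …, U_n` if `n < k`). -/
def lengthPositions (c : List ℕ) (n : ℕ) : Finset ℕ :=
  (Finset.Icc (n + 1 - c.length) n).image (finLength c)

/-- The length `P_n` from which on `lengthPositions c n` is used as an attractor. -/
def threshold (c : List ℕ) (n : ℕ) : ℕ :=
  if n < c.length then finLength c n
  else finLength c n + finLength c (n + 1 - c.length) - finLength c (n - c.length) - 1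

theorem threshold_of_lt {c : List ℕ} {n : ℕ} (hn : n < c.length) :
    threshold c n = finLength c n := if_pos hn

theorem threshold_length_add (c : List ℕ) (j : ℕ) : threshold c (c.length + j) =
    finLength c (c.length + j) + finLength c (j + 1) - finLength c j - 1 := by
  rw [threshold, if_neg (by omega), show c.length + j + 1 - c.length = j + 1 by omega,
    Nat.add_sub_cancel_left]

theorem finLength_le_threshold {c : List ℕ} (hc : WorkingHypothesis c) (n : ℕ) :
    finLength c n ≤ threshold c n := by
  rcases Nat.lt_or_ge n c.length with hn | hn
  · exact (threshold_of_lt hn).ge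
  · obtain ⟨j, rfl⟩ := Nat.exists_eq_add_of_le hn
    have := finLength_strictMono hc (Nat.lt_succ_self j)
    rw [threshold_length_add]
    simp only [Nat.succ_eq_add_one] at this
    omega

namespace IsPowerOne

variable {c w : List ℕ} {l : ℕ}

/-- Here the shape `c = w^ℓ 1` enters: the period `U_n` of `u_c` lasts up to the length from
which on `lengthPositions c (n + 1)` takes over. -/
theorem threshold_succ_le (h : IsPowerOne c w l) (n : ℕ) :
    threshold c (n + 1) ≤ finLength c n + (overlap c w n).length + 1 := by
  rcases Nat.lt_or_ge (n + 1) c.length with hn | hn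
  · rw [threshold_of_lt hn]
    exact h.finLength_succ_le n
  · obtain ⟨j, hj⟩ := Nat.exists_eq_add_of_le hn
    have h1 := h.finLength_succ_le j
    have h2 := h.two_le
    obtain rfl : n = c.length - 1 + j := by omega
    rw [hj, threshold_length_add, h.finLength_add_overlap]
    omega

theorem threshold_lt (h : IsPowerOne c w l) (n : ℕ) : threshold c n < finLength c (n + 1) := by
  have hmono := finLength_strictMono h.working
  rcases Nat.lt_or_ge n c.length with hn | hn
  · rw [threshold_of_lt hn]
    exact hmono (Nat.lt_succ_self n)
  · obtain ⟨j, rfl⟩ := Nat.exists_eq_add_of_le hn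
    have h1 := h.finLength_length_add (j + 1)
    have h2 : 0 < finLength c j := (Nat.zero_le j).trans_lt (lt_finLength h.working j)
    have h3 := hmono (Nat.lt_succ_self (c.length + j))
    have h4 := h.two_le
    rw [threshold_length_add]
    rw [show c.length - 1 + (j + 1) = c.length + j by omega, ← add_assoc] at h1
    simp only [Nat.succ_eq_add_one] at h3
    omega

/-- A set that covers `u_n` without its last letter is completed by `U_n` as long as `u_c` has
period `U_n`. -/
theorem covers_insert_finLength (h : IsPowerOne c w l) {n m : ℕ} {Γ : Finset ℕ}
    (hΓ : Covers (fixedWord c) Γ (finLength c n - 1)) (hm : threshold c n ≤ m)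
    (hm' : m < threshold c (n + 1)) :
    Covers (fixedWord c) (insert (finLength c n) Γ) m := by
  have h1 := h.threshold_succ_le n
  exact hΓ.insert_period ((Nat.zero_le n).trans_lt (lt_finLength h.working n))
    ((finLength_le_threshold h.working n).trans hm) fun i hi => h.fixedWord_add (by omega)

/-- The position `U_n` is added to the previous positions. If `n ≥ k`, the position `U_{n-k}` is
then superfluous: a factor across `U_{n-k}` that avoids `U_{n-k+1}` lies in `u_{n-k+1}` without its
last letter. As `u_n` ends with `u_{n-k}` and `u_{n-k+1}` without its last letter has period
`U_{n-k}`, such a factor also occurs across `U_n`, provided that `m ≥ P_n`. -/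
theorem covers_lengthPositions (h : IsPowerOne c w l) (n : ℕ) {m : ℕ} (hm : threshold c n ≤ m)
    (hm' : m < threshold c (n + 1)) : Covers (fixedWord c) (lengthPositions c n) m := by
  have hmono := finLength_strictMono h.working
  have h2 := h.two_le
  induction n generalizing m with
  | zero =>
    refine (h.covers_insert_finLength (Γ := ∅) ?_ hm hm').mono ?_
    · intro i d hd hi
      rw [finLength_zero] at hi
      omega
    · simp [lengthPositions]
      omega
  | succ n ih =>
    have hpos : 0 < finLength c (n + 1) :=
      (Nat.zero_le _).trans_lt (lt_finLength h.working (n + 1))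
    have hprev : Covers (fixedWord c) (lengthPositions c n) (finLength c (n + 1) - 1) := by
      have h3 := h.threshold_lt n
      have h4 := finLength_le_threshold h.working (n + 1)
      exact ih (by omega) (by omega)
    have hins := h.covers_insert_finLength hprev hm hm'
    rcases Nat.lt_or_ge (n + 1) c.length with hn | hn
    · refine hins.mono ?_
      intro g hg
      simp only [lengthPositions, Finset.mem_insert, Finset.mem_image, Finset.mem_Icc] at hg ⊢
      rcases hg with rfl | ⟨j, hj, rfl⟩
      · exact ⟨n + 1, by omega, rfl⟩
      · exact ⟨j, by omega, rfl⟩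
    · obtain ⟨j, hj⟩ := Nat.exists_eq_add_of_le hn
      have hjn : j < n + 1 := by omega
      have hUj := hmono hjn
      have hUj1 := hmono (Nat.lt_succ_self j)
      simp only [Nat.succ_eq_add_one] at hUj1
      have hthr : threshold c (n + 1) =
          finLength c (n + 1) + finLength c (j + 1) - finLength c j - 1 := by
        rw [hj, threshold_length_add]
      refine (hins.erase (g := finLength c j) ?_).mono ?_
      · intro i d hi hid hidm honly
        have hlast : i + d < finLength c (j + 1) := by
          refine honly _ ?_ hUj1.ne' (by omega)
          simp only [lengthPositions, Finset.mem_insert, Finset.mem_image, Finset.mem_Icc]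
          rcases eq_or_ne j n with rfl | hne
          · exact Or.inl rfl
          · exact Or.inr ⟨j + 1, by omega, rfl⟩
        refine ⟨finLength c (n + 1) - finLength c j + i, by omega, fun t ht => ?_,
          finLength c (n + 1), Finset.mem_insert_self _ _, hUj.ne', by omega, by omega⟩
        rcases Nat.lt_or_ge (i + t) (finLength c j) with hit | hit
        · rw [add_assoc, hj, h.fixedWord_suffix hit]
        · obtain ⟨e, he⟩ := Nat.exists_eq_add_of_le hit
          have h3 := h.finLength_succ_le j
          have h4 := h.threshold_succ_le (n + 1)
          rw [he, h.fixedWord_add (n := j) (by omega),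
            show finLength c (n + 1) - finLength c j + i + t = finLength c (n + 1) + e by omega,
            h.fixedWord_add (by omega)]
      · intro g hg
        simp only [lengthPositions, Finset.mem_erase, Finset.mem_insert, Finset.mem_image,
          Finset.mem_Icc] at hg ⊢
        obtain ⟨hne, rfl | ⟨i, hi, rfl⟩⟩ := hg
        · exact ⟨n + 1, by omega, rfl⟩
        · have : i ≠ j := by rintro rfl; exact hne rfl
          exact ⟨i, by omega, rfl⟩

theorem isStringAttractor_lengthPositions (h : IsPowerOne c w l) (n : ℕ) {m : ℕ}
    (hm : threshold c n ≤ m) (hm' : m < threshold c (n + 1)) :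
    IsStringAttractor (lengthPositions c n) (infPrefix (fixedWord c) m) := by
  refine (h.covers_lengthPositions n hm hm').isStringAttractor fun g hg => ?_
  simp only [lengthPositions, Finset.mem_image, Finset.mem_Icc] at hg ⊢
  obtain ⟨j, hj, rfl⟩ := hg
  have h1 := (finLength_strictMono h.working).monotone hj.2
  have h2 := finLength_le_threshold h.working n
  have h3 := lt_finLength h.working j
  omega

theorem card_lengthPositions (h : IsPowerOne c w l) (n : ℕ) :
    (lengthPositions c n).card = n + 1 - (n + 1 - c.length) := by
  rw [lengthPositions, Finset.card_image_of_injective _ (finLength_strictMono h.working).injective,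
    Nat.card_Icc]

/-- The letter `i` is the last letter of `u_i`. -/
theorem exists_fixedWord_eq (h : IsPowerOne c w l) {i : ℕ} (hi : i < c.length) :
    ∃ j < finLength c i, fixedWord c j = i := by
  have h1 := IsFixedPrefix.finWord c i
  have hlast : (finWord c i).getLast? = some i := by
    rcases i with _ | i
    · rfl
    · rw [h.finWord_succ_eq hi]
      simp
  have hmem := List.mem_of_getLast? hlast
  obtain ⟨j, hj, hji⟩ := List.getElem_of_mem hmem
  exact ⟨j, hj, by rw [← h1.getElem h.working hj, hji]⟩

theorem le_card_of_isStringAttractor (h : IsPowerOne c w l) {i m : ℕ} (hi : i < c.length)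
    (hm : finLength c i ≤ m) {Γ : Finset ℕ}
    (hΓ : IsStringAttractor Γ (infPrefix (fixedWord c) m)) : i + 1 ≤ Γ.card := by
  have h1 := hΓ.card_le (s := Finset.range (i + 1)) ?_
  · simpa using h1
  intro a ha
  rw [Finset.mem_range] at ha
  obtain ⟨j, hj, hja⟩ := h.exists_fixedWord_eq (i := a) (by omega)
  have h2 := (finLength_strictMono h.working).monotone (show a ≤ i by omega)
  exact ⟨j, by omega, hja⟩

end IsPowerOne

/-! ### The attractor profile of the fixed point -/

theorem mainTheorem8 (c : List ℕ) (hc : WorkingHypothesis c)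
    (w : List ℕ) (hw : IsAntiLyndonWord w) (l : ℕ) (hl : 1 ≤ l)
    (hcw : c = wordPow w l ++ [1]) :
    (∀ i m : ℕ, i ≤ c.length - 2 → finLength c i ≤ m → m < finLength c (i + 1) →
      attractorProfile (fixedWord c) m = i + 1) ∧
    (∀ m : ℕ, finLength c (c.length - 1) ≤ m →
      attractorProfile (fixedWord c) m = c.length) := by
  have h : IsPowerOne c w l := ⟨hc, hw, hcw⟩
  have hk := hc.1
  refine ⟨fun i m hi hm hm' => ?_, fun m hm => ?_⟩
  · rw [← threshold_of_lt (by omega)] at hm'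
    refine attractorProfile_eq (h.isStringAttractor_lengthPositions i ?_ hm') ?_
      fun Γ hΓ => h.le_card_of_isStringAttractor (by omega) hm hΓ
    · rwa [threshold_of_lt (by omega)]
    · rw [h.card_lengthPositions]
      omega
  · have hex : ∃ n, m < threshold c (n + 1) :=
      ⟨m, (lt_finLength hc m).trans ((finLength_strictMono hc (Nat.lt_succ_self m)).trans_le
        (finLength_le_threshold hc (m + 1)))⟩
    have hspec := Nat.find_spec hex
    set n := Nat.find hex with hn
    have hkn : c.length - 1 ≤ n := by
      by_contra hlt
      rw [threshold_of_lt (by omega)] at hspec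
      have := (finLength_strictMono hc).monotone (show n + 1 ≤ c.length - 1 by omega)
      omega
    have hlow : threshold c n ≤ m := by
      rcases hkn.eq_or_lt with heq | hlt
      · rw [← heq, threshold_of_lt (by omega)]
        exact hm
      · obtain ⟨n', hn'⟩ := Nat.exists_eq_add_of_le' (show 1 ≤ n by omega)
        rw [hn']
        exact not_lt.1 (Nat.find_min hex (m := n') (by omega))
    refine attractorProfile_eq (h.isStringAttractor_lengthPositions n hlow hspec) ?_ fun Γ hΓ => ?_
    · rw [h.card_lengthPositions]
      omega
    · have := h.le_card_of_isStringAttractor (i := c.length - 1) (by omega) hm hΓ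
      omega
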